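/- Let $n\ge 2$, let $\sigma$ be the surface measure on the unit sphere $S^{n-1}\subset\mathbb{R}^n$ and $\omega_n=\sigma(S^{n-1})$. For a nonempty compact convex set $K\subset\mathbb{R}^n$ with support function $h_K(\theta)=\sup_{y\in K}\langle\theta,y\rangle$, let $$w(K)=\frac1{\omega_n}\int_{S^{n-1}}\bigl(h_K(\theta)+h_K(-\theta)\bigr)\,d\sigma(\theta)$$ be its mean width. A sector is a closed set $S\subset S^{n-1}$ such that the cone $\{r\theta : r\ge 0,\ \theta\in S\}$ is convex; its dual is $S^*=\{y\in S^{n-1} : \langle y,\theta\rangle\ge 0 \text{ for all } \theta\in S\}$. Let $\mathcal{C}$ be the class of sectors $S$ with $S^*\subseteq S$, and for $S\in\mathcal{C}$, $u\in S^*$ put $$\Phi(S,u)=\frac{2}{\omega_n}\int_S\langle\theta,u\rangle\,d\sigma(\theta).$$ A steepest descent curve is a rectifiable curve $\gamma\subset\mathbb{R}^n$ of length $L=\|\gamma\|$ whose arc length representation $x:[0,L]\to\mathbb{R}^n$ satisfies, for almost every $s\in[0,L]$, $\langle x'(s),x(s)-x(\tau)\rangle\ge 0$ for all $\tau\in[0,s]$.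 For $s\in[0,L]$ let $w_\gamma(s)$ be the mean width of the convex hull of $\{x(\tau) : 0\le\tau\le s\}$. Theorem. The minimum $$m_n=\min\{\Phi(S,u) : S\in\mathcal{C},\ u\in S^*\}$$ exists and is a positive number, depending only on $n$. For every steepest descent curve $\gamma\subset\mathbb{R}^n$, the function $w_\gamma$ is differentiable at almost every $s\in[0,\|\gamma\|]$, and $$\frac{d}{ds}w_\gamma(s)\ \ge\ m_n\qquad\text{for almost every } s\in[0,\|\gamma\|].$$ -/

import Mathlib

open MeasureTheory Set Metric
open scoped RealInnerProductSpace

noncomputable section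

namespace SteepestDescent

/-- Euclidean space `ℝⁿ`. -/
abbrev Rn (n : ℕ) : Type := EuclideanSpace ℝ (Fin n)

/-- The unit sphere `Sⁿ⁻¹` of `ℝⁿ`. -/
abbrev Sph (n : ℕ) : Type := sphere (0 : Rn n) 1

/-- The spherical Lebesgue (surface) measure `σ` on `Sⁿ⁻¹`. -/
def sigma (n : ℕ) : Measure (Sph n) := (volume : Measure (Rn n)).toSphere

/-- `ωₙ`, the total surface measure of `Sⁿ⁻¹`. -/
def omega (n : ℕ) : ℝ := (sigma n).real univ

/-- The support function `h_K(x) = sup_{y ∈ K} ⟨x, y⟩` (used for bounded nonempty `K`). -/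
def supportFun {n : ℕ} (K : Set (Rn n)) (x : Rn n) : ℝ :=
  sSup ((fun y : Rn n => ⟪x, y⟫) '' K)

/-- The mean width of `K`: the mean over `θ ∈ Sⁿ⁻¹` of `h_K(θ) + h_K(-θ)`. -/
def meanWidth {n : ℕ} (K : Set (Rn n)) : ℝ :=
  1 / omega n * ∫ θ : Sph n, (supportFun K θ + supportFun K (-(θ : Rn n))) ∂(sigma n)

/-- `x`, restricted to `[0, L]`, is the arc length representation of a rectifiable curve of
length `L`, and the curve is a steepest descent curve: for almost every `s`,
`⟨x'(s), x(s) - x(τ)⟩ ≥ 0` whenever `τ ≤ s`. The values of `x` outside `[0, L]` play no role. -/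
structure IsSteepestDescentCurve {n : ℕ} (x : ℝ → Rn n) (L : ℝ) : Prop where
  length_nonneg : 0 ≤ L
  unitSpeed : HasUnitSpeedOn x (Icc 0 L)
  descent : ∀ᵐ s ∂(volume.restrict (Icc 0 L)),
    ∀ τ ∈ Icc 0 L, τ ≤ s → 0 ≤ ⟪deriv x s, x s - x τ⟫

/-- `w_γ(s)`, the mean width of the convex hull of the arc `{x(τ) : 0 ≤ τ ≤ s}`. -/
def arcMeanWidth {n : ℕ} (x : ℝ → Rn n) (s : ℝ) : ℝ :=
  meanWidth (convexHull ℝ (x '' Icc 0 s))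

/-- A sector: a closed convex subset of the sphere, where convexity means that the cone
`{r θ : r ≥ 0, θ ∈ S}` spanned by `S` is convex. -/
def IsSector {n : ℕ} (S : Set (Sph n)) : Prop :=
  IsClosed S ∧ Convex ℝ {y : Rn n | ∃ r : ℝ, 0 ≤ r ∧ ∃ θ ∈ S, y = r • (θ : Rn n)}

/-- The dual `S*` of a sector. -/
def dualSector {n : ℕ} (S : Set (Sph n)) : Set (Sph n) :=
  {y | ∀ θ ∈ S, 0 ≤ ⟪(y : Rn n), (θ : Rn n)⟫}

/-- The class `𝒞` of the sectors that contain their dual. As soon as `S*` has an element `u`,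
such a sector lies in the closed hemisphere `{θ : ⟨θ, u⟩ ≥ 0}`. -/
def classC (n : ℕ) : Set (Set (Sph n)) :=
  {S | IsSector S ∧ dualSector S ⊆ S}

/-- `Φ(S, u) = (2 / ωₙ) ∫_S ⟨θ, u⟩ dσ(θ)`. -/
def Phi {n : ℕ} (S : Set (Sph n)) (u : Sph n) : ℝ :=
  2 / omega n * ∫ θ in S, ⟪(θ : Rn n), (u : Rn n)⟫ ∂(sigma n)

end SteepestDescent

end

/-!
Why the theorem holds.

*The minimum.* By the bipolar theorem for sectors (`dualSector_dualSector`), the pairs `(S, u)` with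
`S ∈ 𝒞` and `u ∈ S*` are exactly the pairs `(T*, u)`, where `T` is a nonempty compact set of unit
vectors with pairwise nonnegative inner products and `u ∈ T` (`setOf_Phi_eq_image`). These `(T, u)`
form a compact subset of the product of the hyperspace of nonempty compact sets with the sphere, and
`Φ(T*, u)` is continuous in `(T, u)` by dominated convergence: the boundary of the convex cone over
`T*` is Lebesgue null, and off the boundary membership in `T*` is stable under perturbation of `T`
(`continuous_Phi_dualSector`). So the minimum is attained. It is positive because `T` lies in an open
half-space, hence `T*` has nonempty interior, where `⟨·, u⟩ > 0` (`setIntegral_dualSector_pos`).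

*The curve.* The function `w_γ` is monotone, hence differentiable almost everywhere. Distances from a
point already reached do not decrease along the curve, so the chords `x(s) - x(τ)`, `τ ≤ s`, pairwise
form no obtuse angle (`IsSteepestDescentCurve.inner_chord_nonneg`), and therefore the set `S` of
directions in which the arc up to `s` is supported at `x(s)` belongs to `𝒞`. The velocity
`u = x'(s)` is a unit vector for almost every `s` (`ae_norm_deriv_eq_one`), and as a limit of
directions of backward chords it belongs to `S*`. When the curve goes on to `x(t)`, the support
function grows by at least `⟨θ, x(t) - x(s)⟩` in every direction `θ ∈ S`; integrating and dividing by
`t - s` gives `w_γ'(s) ≥ Φ(S, u)` (`IsSteepestDescentCurve.Phi_le_deriv`).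
-/

namespace SteepestDescent

open Filter Topology
open scoped Pointwise

variable {n : ℕ}

/-! ### The sphere and its surface measure -/

lemma inner_sph_self (u : Sph n) : ⟪(u : Rn n), (u : Rn n)⟫ = 1 := by
  rw [real_inner_self_eq_norm_sq, norm_eq_of_mem_sphere, one_pow]

lemma abs_inner_sph_le (θ u : Sph n) : |⟪(θ : Rn n), (u : Rn n)⟫| ≤ 1 := by
  simpa [norm_eq_of_mem_sphere] using abs_real_inner_le_norm (θ : Rn n) (u : Rn n)

lemma exists_sph_smul {x : Rn n} (hx : x ≠ 0) : ∃ θ : Sph n, x = ‖x‖ • (θ : Rn n) := by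
  have h : ‖x‖ ≠ 0 := norm_ne_zero_iff.mpr hx
  refine ⟨⟨‖x‖⁻¹ • x, ?_⟩, ?_⟩
  · simp [norm_smul, h]
  · simp [smul_smul, h]

lemma omega_pos (hn : 2 ≤ n) : 0 < omega n := by
  have : Nontrivial (Rn n) := by
    have : Nonempty (Fin n) := ⟨⟨0, by omega⟩⟩
    infer_instance
  have h : sigma n ≠ 0 := (volume : Measure (Rn n)).toSphere_ne_zero
  have : IsFiniteMeasure (sigma n) := by unfold sigma; infer_instance
  have : NeZero (sigma n) := ⟨h⟩
  exact measureReal_univ_pos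

instance : IsFiniteMeasure (sigma n) := by unfold sigma; infer_instance

instance : (sigma n).IsOpenPosMeasure := by unfold sigma; infer_instance

/-! ### Sectors and duality -/

/-- The unit vectors making a nonnegative inner product with every element of `A`. -/
def polarSector (A : Set (Rn n)) : Set (Sph n) := {θ | ∀ a ∈ A, 0 ≤ ⟪(θ : Rn n), a⟫}

lemma dualSector_eq_polarSector (T : Set (Sph n)) :
    dualSector T = polarSector ((↑) '' T : Set (Rn n)) := by
  ext θ
  simp [dualSector, polarSector]

lemma isClosed_polarSector (A : Set (Rn n)) : IsClosed (polarSector A) := by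
  have : polarSector A = ⋂ a ∈ A, {θ : Sph n | 0 ≤ ⟪(θ : Rn n), a⟫} := by
    ext θ; simp [polarSector]
  rw [this]
  exact isClosed_biInter fun a _ => isClosed_le continuous_const (by fun_prop)

lemma isClosed_dualSector (T : Set (Sph n)) : IsClosed (dualSector T) := by
  rw [dualSector_eq_polarSector]
  exact isClosed_polarSector _

lemma isSector_polarSector (A : Set (Rn n)) : IsSector (polarSector A) := by
  refine ⟨isClosed_polarSector A, ?_⟩
  rintro _ ⟨r, hr, θ, hθ, rfl⟩ _ ⟨s, hs, φ, hφ, rfl⟩ a b ha hb -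
  set w : Rn n := a • r • (θ : Rn n) + b • s • (φ : Rn n) with hw
  by_cases h0 : w = 0
  · exact ⟨0, le_rfl, θ, hθ, by simp [h0]⟩
  · obtain ⟨ψ, hψ⟩ := exists_sph_smul h0
    refine ⟨‖w‖, norm_nonneg _, ψ, fun y hy => ?_, hψ⟩
    have h1 : 0 ≤ ⟪w, y⟫ := by
      rw [hw, inner_add_left]
      simp only [real_inner_smul_left]
      have := hθ y hy
      have := hφ y hy
      positivity
    rw [hψ, real_inner_smul_left] at h1
    exact nonneg_of_mul_nonneg_right h1 (norm_pos_iff.mpr h0)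

/-- The duality that produces elements of `𝒞`: vectors that pairwise form no obtuse angle lie in
the cone over their polar sector, so they test membership of the dual in the sector itself. -/
lemma polarSector_mem_classC {A : Set (Rn n)} (hA : ∀ a ∈ A, ∀ b ∈ A, 0 ≤ ⟪a, b⟫) :
    polarSector A ∈ classC n := by
  refine ⟨isSector_polarSector A, fun z hz a ha => ?_⟩
  by_cases h0 : a = 0
  · simp [h0]
  · obtain ⟨ψ, hψ⟩ := exists_sph_smul h0
    have hmem : ψ ∈ polarSector A := fun b hb => by
      have h1 := hA a ha b hb
      rw [hψ, real_inner_smul_left] at h1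
      exact nonneg_of_mul_nonneg_right h1 (norm_pos_iff.mpr h0)
    rw [hψ, real_inner_smul_right]
    exact mul_nonneg (norm_nonneg _) (hz ψ hmem)

/-- The cone over a closed set of unit vectors is closed, by compactness of the sphere. -/
lemma isClosed_cone {S : Set (Sph n)} (hS : IsClosed S) :
    IsClosed {y : Rn n | ∃ r : ℝ, 0 ≤ r ∧ ∃ θ ∈ S, y = r • (θ : Rn n)} := by
  have h : {y : Rn n | ∃ r : ℝ, 0 ≤ r ∧ ∃ θ ∈ S, y = r • (θ : Rn n)} =
      Prod.fst '' {p : Rn n × Sph n | p.2 ∈ S ∧ p.1 = ‖p.1‖ • (p.2 : Rn n)} := by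
    ext y
    constructor
    · rintro ⟨r, hr, θ, hθ, rfl⟩
      exact ⟨(_, θ), ⟨hθ, by simp [norm_smul, abs_of_nonneg hr]⟩, rfl⟩
    · rintro ⟨⟨y, θ⟩, ⟨h1, h2⟩, rfl⟩
      exact ⟨‖y‖, norm_nonneg _, θ, h1, h2⟩
  rw [h]
  refine isClosedMap_fst_of_compactSpace _ (IsClosed.inter (hS.preimage continuous_snd) ?_)
  exact isClosed_eq (by fun_prop) (by fun_prop)

/-- The bipolar theorem for sectors. -/
lemma dualSector_dualSector {S : Set (Sph n)} (hS : IsSector S) (hne : S.Nonempty) :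
    dualSector (dualSector S) = S := by
  refine Subset.antisymm (fun θ hθ => ?_) fun θ hθ y hy => by
    rw [real_inner_comm]; exact hy θ hθ
  by_contra hnot
  have hmem : (θ : Rn n) ∉ {y : Rn n | ∃ r : ℝ, 0 ≤ r ∧ ∃ θ ∈ S, y = r • (θ : Rn n)} := by
    rintro ⟨r, hr, φ, hφ, h⟩
    have h1 : r = 1 := by
      have := congrArg norm h
      simpa [norm_smul, abs_of_nonneg hr] using this.symm
    rw [h1, one_smul] at h
    exact hnot (Subtype.ext h ▸ hφ)
  obtain ⟨f, c, hf, hc⟩ := geometric_hahn_banach_closed_point hS.2 (isClosed_cone hS.1) hmem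
  have hc0 : 0 < c := by
    obtain ⟨φ, hφ⟩ := hne
    simpa using hf 0 ⟨0, le_rfl, φ, hφ, by simp⟩
  -- a linear functional bounded above on a cone is nonpositive there
  have hneg : ∀ φ ∈ S, f (φ : Rn n) ≤ 0 := by
    intro φ hφ
    by_contra hpos
    push Not at hpos
    have := hf ((c / f φ) • (φ : Rn n)) ⟨_, by positivity, φ, hφ, rfl⟩
    rw [map_smul, smul_eq_mul, div_mul_cancel₀ _ hpos.ne'] at this
    exact lt_irrefl _ this
  set v := (InnerProductSpace.toDual ℝ (Rn n)).symm f with hv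
  have hfv : ∀ y, ⟪v, y⟫ = f y := fun y => InnerProductSpace.toDual_symm_apply
  have hv0 : -v ≠ 0 := by
    intro h
    have := hfv θ
    rw [neg_eq_zero.mp h, inner_zero_left] at this
    linarith
  obtain ⟨ψ, hψ⟩ := exists_sph_smul hv0
  have hvpos := norm_pos_iff.mpr hv0
  have hψS : ψ ∈ dualSector S := fun φ hφ => by
    have h1 : 0 ≤ ⟪-v, (φ : Rn n)⟫ := by
      rw [inner_neg_left, hfv]
      linarith [hneg φ hφ]
    rw [hψ, real_inner_smul_left] at h1
    exact nonneg_of_mul_nonneg_right h1 hvpos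
  have h2 : 0 ≤ ⟪-v, (θ : Rn n)⟫ := by
    rw [hψ, real_inner_smul_left, real_inner_comm]
    exact mul_nonneg (norm_nonneg _) (hθ ψ hψS)
  rw [inner_neg_left, hfv] at h2
  linarith

/-! ### Null boundaries and positivity of `Φ` -/

/-- The frontier of a convex set invariant under positive scaling leaves a null trace on the
sphere. -/
lemma sigma_preimage_frontier_eq_zero {D : Set (Rn n)} (hD : Convex ℝ D)
    (hsmul : ∀ r : ℝ, 0 < r → (fun x : Rn n => r • x) ⁻¹' D = D) :
    sigma n ((↑) ⁻¹' frontier D) = 0 := by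
  rw [sigma, Measure.toSphere_apply' _ (isClosed_frontier.preimage
    continuous_subtype_val).measurableSet]
  refine mul_eq_zero_of_right _ (measure_mono_null ?_ (hD.addHaar_frontier volume))
  rintro _ ⟨r, hr, _, ⟨θ, hθ, rfl⟩, rfl⟩
  have h := (Homeomorph.smulOfNeZero r hr.1.ne').preimage_frontier D
  have h' : (Homeomorph.smulOfNeZero r hr.1.ne') ⁻¹' D = D := hsmul r hr.1
  rw [h'] at h
  have h2 : (θ : Rn n) ∈ frontier D := hθ
  rw [← h] at h2
  exact h2

/-- Up to a null set, a sector `T*` consists of its interior directions, those making a positive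
inner product with every element of `T`. -/
lemma ae_inner_pos_of_mem_dualSector (T : Set (Sph n)) :
    ∀ᵐ θ ∂(sigma n), θ ∈ dualSector T → ∀ y ∈ T, 0 < ⟪(θ : Rn n), (y : Rn n)⟫ := by
  set D : Set (Rn n) := {x | ∀ y ∈ T, 0 ≤ ⟪x, (y : Rn n)⟫} with hDdef
  have hD : Convex ℝ D := by
    intro x hx z hz a b ha hb _ y hy
    rw [inner_add_left, real_inner_smul_left, real_inner_smul_left]
    exact add_nonneg (mul_nonneg ha (hx y hy)) (mul_nonneg hb (hz y hy))
  have hs : ∀ r : ℝ, 0 < r → (fun x : Rn n => r • x) ⁻¹' D = D := by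
    intro r hr
    ext x
    simp only [hDdef, mem_preimage, mem_ofPred_eq, real_inner_smul_left]
    exact forall₂_congr fun y _ => mul_nonneg_iff_of_pos_left hr
  have hnull := sigma_preimage_frontier_eq_zero hD hs
  filter_upwards [measure_eq_zero_iff_ae_notMem.mp hnull] with θ hθ hmem y hy
  refine lt_of_le_of_ne (hmem y hy) fun h0 => hθ ?_
  refine ⟨subset_closure hmem, fun hint => ?_⟩
  -- moving from `θ` against `y` leaves `D` at once
  have hcont : Tendsto (fun ε : ℝ => (θ : Rn n) - ε • (y : Rn n)) (𝓝[>] 0) (𝓝 (θ : Rn n)) := by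
    have : Continuous fun ε : ℝ => (θ : Rn n) - ε • (y : Rn n) := by fun_prop
    simpa using (this.tendsto 0).mono_left nhdsWithin_le_nhds
  obtain ⟨ε, hε, hεpos⟩ := ((hcont.eventually (mem_interior_iff_mem_nhds.mp hint)).and
    self_mem_nhdsWithin).exists
  have h1 := hε y hy
  rw [inner_sub_left, real_inner_smul_left, inner_sph_self, ← h0] at h1
  have : (0 : ℝ) < ε := hεpos
  linarith

lemma integrable_inner_sph (v : Rn n) : Integrable (fun θ : Sph n => ⟪(θ : Rn n), v⟫) (sigma n) :=
  (by fun_prop : Continuous fun θ : Sph n => ⟪(θ : Rn n), v⟫).integrable_of_hasCompactSupport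
    (HasCompactSupport.of_compactSpace _)

/-- A compact family of unit vectors without obtuse angles lies in an open half-space: the sum of
the centres of a finite cover by unit balls makes a positive inner product with all of them. -/
lemma exists_forall_inner_ge {T : Set (Sph n)} (hT : IsCompact T)
    (hpair : ∀ y ∈ T, ∀ z ∈ T, 0 ≤ ⟪(y : Rn n), (z : Rn n)⟫) :
    ∃ z : Rn n, ∀ y ∈ T, 1 / 2 ≤ ⟪z, (y : Rn n)⟫ := by
  obtain ⟨t, htT, htf, hcov⟩ := finite_cover_balls_of_compact hT one_pos
  refine ⟨∑ w ∈ htf.toFinset, (w : Rn n), fun y hy => ?_⟩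
  obtain ⟨w, hw, hyw⟩ := mem_iUnion₂.mp (hcov hy)
  have h1 : 1 / 2 ≤ ⟪(w : Rn n), (y : Rn n)⟫ := by
    have h2 : ‖(y : Rn n) - w‖ < 1 := by
      rw [← dist_eq_norm]; exact hyw
    have h3 := norm_sub_sq_real (y : Rn n) (w : Rn n)
    rw [norm_eq_of_mem_sphere, norm_eq_of_mem_sphere, real_inner_comm] at h3
    nlinarith [norm_nonneg ((y : Rn n) - w)]
  rw [sum_inner]
  refine h1.trans (Finset.single_le_sum (f := fun w : Sph n => ⟪(w : Rn n), (y : Rn n)⟫)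
    (fun i hi => hpair i (htT (htf.mem_toFinset.mp hi)) y hy) (htf.mem_toFinset.mpr hw))

/-- The sector `T*` contains a ball of directions on which the integrand is positive. -/
lemma setIntegral_dualSector_pos {T : Set (Sph n)} (hT : IsCompact T)
    (hpair : ∀ y ∈ T, ∀ z ∈ T, 0 ≤ ⟪(y : Rn n), (z : Rn n)⟫) {u : Sph n} (hu : u ∈ T) :
    0 < ∫ θ in dualSector T, ⟪(θ : Rn n), (u : Rn n)⟫ ∂(sigma n) := by
  have hmeas := (isClosed_dualSector T).measurableSet
  rw [setIntegral_pos_iff_support_of_nonneg_ae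
    ((ae_restrict_iff' hmeas).mpr (.of_forall fun θ hθ => hθ u hu))
    (integrable_inner_sph _).integrableOn]
  obtain ⟨z, hz⟩ := exists_forall_inner_ge hT hpair
  have hz0 : z ≠ 0 := by
    rintro rfl
    have := hz u hu
    rw [inner_zero_left] at this
    linarith
  obtain ⟨φ, hφ⟩ := exists_sph_smul hz0
  have hzpos := norm_pos_iff.mpr hz0
  have hr : 0 < 1 / (2 * ‖z‖) := by positivity
  refine (isOpen_ball.measure_pos (sigma n) ⟨φ, mem_ball_self hr⟩).trans_le (measure_mono ?_)
  have key : ∀ θ ∈ ball φ (1 / (2 * ‖z‖)), ∀ y ∈ T, 0 < ⟪(θ : Rn n), (y : Rn n)⟫ := by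
    intro θ hθ y hy
    have h1 : 1 / (2 * ‖z‖) ≤ ⟪(φ : Rn n), (y : Rn n)⟫ := by
      have := hz y hy
      rw [hφ, real_inner_smul_left] at this
      rw [div_le_iff₀ (by positivity)]
      linarith
    have h2 : ‖(θ : Rn n) - φ‖ < 1 / (2 * ‖z‖) := by
      rw [← dist_eq_norm]; exact hθ
    have h3 := abs_real_inner_le_norm ((θ : Rn n) - φ) (y : Rn n)
    rw [norm_eq_of_mem_sphere, mul_one, inner_sub_left] at h3
    linarith [(abs_le.mp h3).1]
  exact fun θ hθ => ⟨(key θ hθ u hu).ne', fun y hy => (key θ hθ y hy).le⟩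

/-! ### Existence of the minimum -/

lemma isClosed_setOf_mem_nonemptyCompacts {X : Type*} [TopologicalSpace X] [T2Space X] :
    IsClosed {p : TopologicalSpace.NonemptyCompacts X × X | p.2 ∈ p.1} := by
  have hc : Continuous fun p : TopologicalSpace.NonemptyCompacts X × X =>
      ({p.2} : TopologicalSpace.NonemptyCompacts X) ×ˢ p.1 :=
    TopologicalSpace.NonemptyCompacts.continuous_prod.comp
      ((TopologicalSpace.NonemptyCompacts.continuous_singleton.comp continuous_snd).prodMk
        continuous_fst)
  convert (TopologicalSpace.NonemptyCompacts.isClosed_inter_nonempty_of_isClosed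
    (isClosed_diagonal (X := X))).preimage hc using 1
  ext p
  constructor
  · intro h
    exact ⟨(p.2, p.2), ⟨rfl, h⟩, rfl⟩
  · rintro ⟨⟨y, z⟩, ⟨hy, hz⟩, hyz⟩
    obtain rfl : y = z := hyz
    obtain rfl : y = p.2 := hy
    exact hz

lemma isClosed_setOf_forall_mem_nonemptyCompacts {X : Type*} [TopologicalSpace X]
    {F : Set (X × X)} (hF : IsClosed F) :
    IsClosed {K : TopologicalSpace.NonemptyCompacts X | ∀ y ∈ K, ∀ z ∈ K, (y, z) ∈ F} := by
  have hc : Continuous fun K : TopologicalSpace.NonemptyCompacts X => K ×ˢ K :=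
    TopologicalSpace.NonemptyCompacts.continuous_prod.comp (continuous_id.prodMk continuous_id)
  convert (TopologicalSpace.NonemptyCompacts.isClosed_subsets_of_isClosed hF).preimage hc using 1
  ext K
  constructor
  · rintro h ⟨y, z⟩ ⟨hy, hz⟩
    exact h y hy z hz
  · intro h y hy z hz
    exact h (show (y, z) ∈ _ from ⟨hy, hz⟩)

/-- The pairs `(T, u)` that parametrize the pairs `(S, u)` of the minimum problem, by `T = S*`. -/
def dualPairs (n : ℕ) : Set (TopologicalSpace.NonemptyCompacts (Sph n) × Sph n) :=
  {p | p.2 ∈ p.1 ∧ ∀ y ∈ p.1, ∀ z ∈ p.1, 0 ≤ ⟪(y : Rn n), (z : Rn n)⟫}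

lemma isCompact_dualPairs : IsCompact (dualPairs n) := by
  have hF : IsClosed {q : Sph n × Sph n | 0 ≤ ⟪(q.1 : Rn n), (q.2 : Rn n)⟫} :=
    isClosed_le continuous_const (by fun_prop)
  exact (isClosed_setOf_mem_nonemptyCompacts.inter
    ((isClosed_setOf_forall_mem_nonemptyCompacts hF).preimage continuous_fst)).isCompact

/-- `Φ(T*, u)` depends continuously on `(T, u)`: away from the null set of the `θ ∈ T*` orthogonal
to some `y ∈ T`, membership of `θ` in `T*` is stable under small changes of `T`. -/
lemma continuous_Phi_dualSector :
    Continuous fun p : TopologicalSpace.NonemptyCompacts (Sph n) × Sph n =>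
      Phi (dualSector (p.1 : Set (Sph n))) p.2 := by
  refine continuous_const.mul ?_
  have hrw : ∀ p : TopologicalSpace.NonemptyCompacts (Sph n) × Sph n,
      ∫ θ in dualSector (p.1 : Set (Sph n)), ⟪(θ : Rn n), (p.2 : Rn n)⟫ ∂(sigma n) =
      ∫ θ, (dualSector (p.1 : Set (Sph n))).indicator
        (fun θ : Sph n => ⟪(θ : Rn n), (p.2 : Rn n)⟫) θ ∂(sigma n) :=
    fun p => (integral_indicator (isClosed_dualSector _).measurableSet).symm
  simp_rw [hrw]
  rw [continuous_iff_continuousAt]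
  intro p
  refine tendsto_integral_filter_of_dominated_convergence (fun _ => 1) ?_ ?_
    (integrable_const _) ?_
  · exact .of_forall fun q => ((integrable_inner_sph _).indicator
      (isClosed_dualSector _).measurableSet).aestronglyMeasurable
  · refine .of_forall fun q => .of_forall fun θ => ?_
    exact (norm_indicator_le_norm_self _ _).trans (abs_inner_sph_le θ q.2)
  · filter_upwards [ae_inner_pos_of_mem_dualSector (p.1 : Set (Sph n))] with θ hθ
    by_cases hmem : θ ∈ dualSector (p.1 : Set (Sph n))
    · have hU : IsOpen {y : Sph n | 0 < ⟪(θ : Rn n), (y : Rn n)⟫} :=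
        isOpen_lt continuous_const (by fun_prop)
      have hev : ∀ᶠ q in 𝓝 p, (q.1 : Set (Sph n)) ⊆ {y : Sph n | 0 < ⟪(θ : Rn n), (y : Rn n)⟫} :=
        ((TopologicalSpace.NonemptyCompacts.isOpen_subsets_of_isOpen hU).preimage
          continuous_fst).mem_nhds (show _ from hθ hmem)
      rw [indicator_of_mem hmem]
      have hc : Continuous fun q : TopologicalSpace.NonemptyCompacts (Sph n) × Sph n =>
        ⟪(θ : Rn n), (q.2 : Rn n)⟫ := by fun_prop
      refine (hc.tendsto p).congr' ?_
      filter_upwards [hev] with q hq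
      rw [indicator_of_mem]
      exact fun y hy => (hq hy).le
    · have hV : IsOpen {y : Sph n | ⟪(θ : Rn n), (y : Rn n)⟫ < 0} :=
        isOpen_lt (by fun_prop) continuous_const
      have hne : ((p.1 : Set (Sph n)) ∩ {y : Sph n | ⟪(θ : Rn n), (y : Rn n)⟫ < 0}).Nonempty := by
        simp only [dualSector, mem_ofPred_eq, not_forall, not_le] at hmem
        obtain ⟨y, hy, h⟩ := hmem
        exact ⟨y, hy, h⟩
      have hev : ∀ᶠ q in 𝓝 p,
          ((q.1 : Set (Sph n)) ∩ {y : Sph n | ⟪(θ : Rn n), (y : Rn n)⟫ < 0}).Nonempty :=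
        ((TopologicalSpace.NonemptyCompacts.isOpen_inter_nonempty_of_isOpen hV).preimage
          continuous_fst).mem_nhds hne
      rw [indicator_of_notMem hmem]
      refine tendsto_const_nhds.congr' ?_
      filter_upwards [hev] with q hq
      obtain ⟨y, hy, h⟩ := hq
      rw [indicator_of_notMem]
      exact fun hq' => absurd (hq' y hy) (not_le.mpr h)

lemma setOf_Phi_eq_image : {r : ℝ | ∃ S ∈ classC n, ∃ u ∈ dualSector S, r = Phi S u} =
    (fun p : TopologicalSpace.NonemptyCompacts (Sph n) × Sph n =>
      Phi (dualSector (p.1 : Set (Sph n))) p.2) '' dualPairs n := by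
  ext r
  constructor
  · rintro ⟨S, hS, u, hu, rfl⟩
    refine ⟨(⟨⟨dualSector S, (isClosed_dualSector S).isCompact⟩, ⟨u, hu⟩⟩, u),
      ⟨hu, fun y hy z hz => hy z (hS.2 hz)⟩, ?_⟩
    change Phi (dualSector (dualSector S)) u = _
    rw [dualSector_dualSector hS.1 ⟨u, hS.2 hu⟩]
  · rintro ⟨⟨T, u⟩, ⟨hu, hpair⟩, rfl⟩
    refine ⟨dualSector T, ?_, u, fun θ hθ => ?_, rfl⟩
    · rw [dualSector_eq_polarSector]
      refine polarSector_mem_classC ?_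
      rintro _ ⟨y, hy, rfl⟩ _ ⟨z, hz, rfl⟩
      exact hpair y hy z hz
    · rw [real_inner_comm]
      exact hθ u hu

lemma exists_isLeast_Phi (hn : 2 ≤ n) :
    ∃ m : ℝ, 0 < m ∧ IsLeast {r : ℝ | ∃ S ∈ classC n, ∃ u ∈ dualSector S, r = Phi S u} m := by
  have : Nonempty (Sph n) := by
    have : Nonempty (Fin n) := ⟨⟨0, by omega⟩⟩
    exact (NormedSpace.sphere_nonempty.mpr zero_le_one).to_subtype
  obtain ⟨e⟩ := ‹Nonempty (Sph n)›
  -- `T = {e}` corresponds to the closed hemisphere around `e`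
  have hne : (dualPairs n).Nonempty := by
    refine ⟨({e}, e), rfl, ?_⟩
    rintro _ rfl _ rfl
    exact real_inner_self_nonneg
  obtain ⟨p, hp, hmin⟩ := isCompact_dualPairs.exists_isMinOn hne
    (continuous_Phi_dualSector (n := n)).continuousOn
  refine ⟨Phi (dualSector (p.1 : Set (Sph n))) p.2,
    mul_pos (div_pos two_pos (omega_pos hn))
      (setIntegral_dualSector_pos p.1.isCompact hp.2 hp.1), ?_⟩
  rw [setOf_Phi_eq_image]
  refine ⟨⟨p, hp, rfl⟩, ?_⟩
  rintro _ ⟨q, hq, rfl⟩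
  exact hmin hq

/-! ### Support functions and mean width -/

lemma bddAbove_inner_image {K : Set (Rn n)} (hK : Bornology.IsBounded K) (x : Rn n) :
    BddAbove ((fun y : Rn n => ⟪x, y⟫) '' K) := by
  obtain ⟨R, hR⟩ := hK.exists_norm_le
  refine ⟨‖x‖ * R, ?_⟩
  rintro _ ⟨y, hy, rfl⟩
  exact (real_inner_le_norm x y).trans (by gcongr; exact hR y hy)

lemma inner_le_supportFun {K : Set (Rn n)} (hK : Bornology.IsBounded K) (x : Rn n) {y : Rn n}
    (hy : y ∈ K) : ⟪x, y⟫ ≤ supportFun K x :=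
  le_csSup (bddAbove_inner_image hK x) ⟨y, hy, rfl⟩

lemma supportFun_le {K : Set (Rn n)} (hne : K.Nonempty) {x : Rn n} {c : ℝ}
    (h : ∀ y ∈ K, ⟪x, y⟫ ≤ c) : supportFun K x ≤ c :=
  csSup_le (hne.image _) (by rintro _ ⟨y, hy, rfl⟩; exact h y hy)

lemma supportFun_mono {K K' : Set (Rn n)} (hne : K.Nonempty) (hK' : Bornology.IsBounded K')
    (h : K ⊆ K') (x : Rn n) : supportFun K x ≤ supportFun K' x :=
  supportFun_le hne fun _ hy => inner_le_supportFun hK' x (h hy)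

lemma continuous_supportFun {K : Set (Rn n)} (hne : K.Nonempty) (hK : Bornology.IsBounded K) :
    Continuous (supportFun K) := by
  obtain ⟨R, hR⟩ := hK.exists_norm_le
  refine (LipschitzWith.of_le_add_mul' R fun x z => ?_).continuous
  refine supportFun_le hne fun y hy => ?_
  have h1 := inner_le_supportFun hK z hy
  have h2 : ⟪x - z, y⟫ ≤ dist x z * R := by
    rw [dist_eq_norm]
    exact (real_inner_le_norm _ y).trans (by gcongr; exact hR y hy)
  rw [inner_sub_left] at h2
  linarith

lemma integrable_supportFun {K : Set (Rn n)} (hne : K.Nonempty) (hK : Bornology.IsBounded K) :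
    Integrable (fun θ : Sph n => supportFun K θ) (sigma n) :=
  ((continuous_supportFun hne hK).comp continuous_subtype_val).integrable_of_hasCompactSupport
    (HasCompactSupport.of_compactSpace _)

lemma measurePreserving_neg_sigma :
    MeasurePreserving (fun θ : Sph n => -θ) (sigma n) (sigma n) := by
  have hc : Continuous fun θ : Sph n => -θ := continuous_neg
  refine ⟨hc.measurable, Measure.ext fun A hA => ?_⟩
  rw [Measure.map_apply hc.measurable hA, sigma, Measure.toSphere_apply' _ hA,
    Measure.toSphere_apply' _ (hc.measurable hA)]
  congr 1
  rw [← Measure.measure_neg volume (Ioo (0 : ℝ) 1 • ((↑) '' A : Set (Rn n)))]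
  congr 1
  ext y
  simp only [Set.mem_smul, mem_image, mem_preimage, Set.mem_neg]
  constructor
  · rintro ⟨r, hr, _, ⟨θ, hθ, rfl⟩, rfl⟩
    exact ⟨r, hr, _, ⟨-θ, hθ, rfl⟩, by simp⟩
  · rintro ⟨r, hr, _, ⟨θ, hθ, rfl⟩, h⟩
    exact ⟨r, hr, _, ⟨-θ, by simpa using hθ, rfl⟩, by simpa [neg_eq_iff_eq_neg] using h⟩

/-- By the symmetry of the sphere both terms of the mean width contribute equally. -/
lemma meanWidth_eq {K : Set (Rn n)} (hne : K.Nonempty) (hK : Bornology.IsBounded K) :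
    meanWidth K = 2 / omega n * ∫ θ : Sph n, supportFun K θ ∂(sigma n) := by
  have hmp := measurePreserving_neg_sigma (n := n)
  have hemb : MeasurableEmbedding fun θ : Sph n => -θ := (Homeomorph.neg (Sph n)).measurableEmbedding
  have hint := integrable_supportFun hne hK
  have h1 := hmp.integral_comp hemb (fun θ : Sph n => supportFun K θ)
  have h2 : Integrable (fun θ : Sph n => supportFun K (-(θ : Rn n))) (sigma n) :=
    (hmp.integrable_comp_emb hemb).mpr hint
  rw [meanWidth, integral_add hint h2]
  simp only [coe_neg_sphere] at h1
  rw [h1]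
  ring

lemma meanWidth_mono {K K' : Set (Rn n)} (hne : K.Nonempty) (hK' : Bornology.IsBounded K')
    (h : K ⊆ K') : meanWidth K ≤ meanWidth K' := by
  rw [meanWidth_eq hne (hK'.subset h), meanWidth_eq (hne.mono h) hK']
  refine mul_le_mul_of_nonneg_left ?_ (div_nonneg zero_le_two measureReal_nonneg)
  exact integral_mono (integrable_supportFun hne (hK'.subset h))
    (integrable_supportFun (hne.mono h) hK') fun θ => supportFun_mono hne hK' h θ

/-- Growth of the mean width: on the directions `S` in which `K` is supported at `p`, the support
function of a larger set containing `q` grows by at least `⟨θ, q - p⟩`. -/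
lemma le_meanWidth_sub {K K' : Set (Rn n)} (hne : K.Nonempty) (hK' : Bornology.IsBounded K')
    (h : K ⊆ K') {S : Set (Sph n)} (hS : MeasurableSet S) {p q : Rn n} (hq : q ∈ K')
    (hp : ∀ θ ∈ S, ∀ y ∈ K, ⟪(θ : Rn n), y⟫ ≤ ⟪(θ : Rn n), p⟫) :
    2 / omega n * ∫ θ in S, ⟪(θ : Rn n), q - p⟫ ∂(sigma n) ≤ meanWidth K' - meanWidth K := by
  have hi := integrable_supportFun hne (hK'.subset h)
  have hi' := integrable_supportFun (hne.mono h) hK'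
  rw [meanWidth_eq hne (hK'.subset h), meanWidth_eq (hne.mono h) hK', ← mul_sub,
    ← integral_sub hi' hi]
  refine mul_le_mul_of_nonneg_left ?_ (div_nonneg zero_le_two measureReal_nonneg)
  rw [← integral_indicator hS]
  refine integral_mono ((integrable_inner_sph _).indicator hS) (hi'.sub hi) fun θ => ?_
  by_cases hθ : θ ∈ S
  · rw [indicator_of_mem hθ]
    have h1 := supportFun_le hne (hp θ hθ)
    have h2 := inner_le_supportFun hK' (θ : Rn n) hq
    simp only [inner_sub_right]
    linarith
  · rw [indicator_of_notMem hθ]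
    exact sub_nonneg.mpr (supportFun_mono hne hK' h θ)

/-! ### Curves parametrized by arc length -/

lemma lipschitzOnWith_of_hasUnitSpeedOn {x : ℝ → Rn n} {s : Set ℝ} (h : HasUnitSpeedOn x s) :
    LipschitzOnWith 1 x s := by
  have key : ∀ p ∈ s, ∀ q ∈ s, p ≤ q → dist (x p) (x q) ≤ dist p q := by
    intro p hp q hq hpq
    have h1 := eVariationOn.edist_le x (s := s ∩ Icc p q) ⟨hp, left_mem_Icc.mpr hpq⟩
      ⟨hq, right_mem_Icc.mpr hpq⟩
    rw [h hp hq, edist_dist, ENNReal.ofReal_le_ofReal_iff (by simpa using hpq)] at h1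
    rw [dist_comm p q, Real.dist_eq, abs_of_nonneg (sub_nonneg.mpr hpq)]
    simpa using h1
  refine LipschitzOnWith.of_dist_le_mul fun p hp q hq => ?_
  rw [NNReal.coe_one, one_mul]
  rcases le_total p q with hpq | hpq
  · exact key p hp q hq hpq
  · rw [dist_comm, dist_comm p]
    exact key q hq p hp hpq

lemma ae_mem_Ioo (a b : ℝ) : ∀ᵐ t ∂(volume.restrict (Icc a b)), t ∈ Ioo a b := by
  rw [← restrict_Ioo_eq_restrict_Icc]
  exact ae_restrict_mem measurableSet_Ioo

lemma ae_differentiableAt_of_lipschitzOnWith {x : ℝ → Rn n} {a b : ℝ}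
    (h : LipschitzOnWith 1 x (Icc a b)) :
    ∀ᵐ t ∂(volume.restrict (Icc a b)), DifferentiableAt ℝ x t ∧ ‖deriv x t‖ ≤ 1 := by
  filter_upwards [ae_mem_Ioo a b, h.ae_differentiableWithinAt_real measurableSet_Icc] with t ht hd
  have hnhds := Icc_mem_nhds ht.1 ht.2
  exact ⟨hd.differentiableAt hnhds, norm_deriv_le_of_lipschitzOn hnhds h⟩

lemma intervalIntegrable_norm_deriv {x : ℝ → Rn n} {a b : ℝ} (hab : a ≤ b)
    (h : LipschitzOnWith 1 x (Icc a b)) :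
    IntervalIntegrable (fun t => ‖deriv x t‖) volume a b := by
  rw [intervalIntegrable_iff_integrableOn_Icc_of_le hab]
  refine Measure.integrableOn_of_bounded (M := 1) measure_Icc_lt_top.ne
    (measurable_deriv x).norm.aestronglyMeasurable ?_
  filter_upwards [ae_differentiableAt_of_lipschitzOnWith h] with t ht
  simpa using ht.2

/-- The chord is at most the integral of the speed: apply the fundamental theorem of calculus for
absolutely continuous real functions to `t ↦ ⟨v, x t⟩`, where `v` is the chord. -/
lemma norm_sub_le_integral_norm_deriv {x : ℝ → Rn n} {a b : ℝ} (hab : a ≤ b)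
    (h : LipschitzOnWith 1 x (Icc a b)) : ‖x b - x a‖ ≤ ∫ t in a..b, ‖deriv x t‖ := by
  set v := x b - x a with hv
  have hf : AbsolutelyContinuousOnInterval (fun t => ⟪v, x t⟫) a b := by
    refine LipschitzOnWith.absolutelyContinuousOnInterval (K := ‖innerSL ℝ v‖₊ * 1) ?_
    rw [uIcc_of_le hab]
    exact (innerSL ℝ v).lipschitz.comp_lipschitzOnWith h
  have h1 := hf.integral_deriv_eq_sub
  have h2 : ∫ t in a..b, deriv (fun t => ⟪v, x t⟫) t ≤ ∫ t in a..b, ‖v‖ * ‖deriv x t‖ := by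
    refine intervalIntegral.integral_mono_ae_restrict hab hf.intervalIntegrable_deriv
      ((intervalIntegrable_norm_deriv hab h).const_mul _) ?_
    filter_upwards [ae_differentiableAt_of_lipschitzOnWith h] with t ht
    have hd : HasDerivAt (fun t => ⟪v, x t⟫) ⟪v, deriv x t⟫ t := by
      simpa using (hasDerivAt_const t v).inner ℝ ht.1.hasDerivAt
    rw [hd.deriv]
    exact real_inner_le_norm _ _
  rw [h1, intervalIntegral.integral_const_mul, ← inner_sub_right, ← hv,
    real_inner_self_eq_norm_mul_norm] at h2
  rcases (norm_nonneg v).eq_or_lt with h0 | h0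
  · rw [← h0]
    exact intervalIntegral.integral_nonneg hab fun t _ => norm_nonneg _
  · exact le_of_mul_le_mul_left h2 h0

/-- A curve parametrized by arc length has unit speed almost everywhere: its length is at most
`∫ ‖x'‖`, while `‖x'‖ ≤ 1`. -/
lemma ae_norm_deriv_eq_one {x : ℝ → Rn n} {L : ℝ} (hL : 0 ≤ L)
    (h : HasUnitSpeedOn x (Icc 0 L)) :
    ∀ᵐ t ∂(volume.restrict (Icc 0 L)), ‖deriv x t‖ = 1 := by
  have hlip := lipschitzOnWith_of_hasUnitSpeedOn h
  have hint := intervalIntegrable_norm_deriv hL hlip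
  set F : ℝ → ℝ := fun t => ∫ r in (0 : ℝ)..t, ‖deriv x r‖ with hF
  have hFsub : ∀ p ∈ Icc 0 L, ∀ q ∈ Icc 0 L, F q - F p = ∫ r in p..q, ‖deriv x r‖ := by
    intro p hp q hq
    refine intervalIntegral.integral_interval_sub_left (hint.mono_set ?_) (hint.mono_set ?_)
    · exact uIcc_subset_uIcc left_mem_uIcc (by rwa [uIcc_of_le hL])
    · exact uIcc_subset_uIcc left_mem_uIcc (by rwa [uIcc_of_le hL])
  have hle : ∀ p ∈ Icc 0 L, ∀ q ∈ Icc 0 L, p ≤ q → ‖x q - x p‖ ≤ F q - F p := by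
    intro p hp q hq hpq
    rw [hFsub p hp q hq]
    exact norm_sub_le_integral_norm_deriv hpq (hlip.mono (Icc_subset_Icc hp.1 hq.2))
  have hmono : MonotoneOn F (Icc 0 L) := fun p hp q hq hpq =>
    sub_nonneg.mp ((norm_nonneg _).trans (hle p hp q hq hpq))
  -- chords of `x` are bounded by the increments of `F`, so the length `L` is at most `F L - F 0`
  have hvar : eVariationOn x (Icc 0 L) ≤ eVariationOn F (Icc 0 L) := by
    refine iSup_le fun p => le_trans (Finset.sum_le_sum fun i _ => ?_)
      (eVariationOn.sum_le p.2.2.1 p.2.2.2)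
    rw [edist_dist, edist_dist]
    refine ENNReal.ofReal_le_ofReal ?_
    rw [dist_eq_norm, Real.dist_eq]
    exact (hle _ (p.2.2.2 i) _ (p.2.2.2 (i + 1)) (p.2.2.1 i.le_succ)).trans (le_abs_self _)
  have h0 : (0 : ℝ) ∈ Icc 0 L := left_mem_Icc.mpr hL
  have hL' : L ∈ Icc 0 L := right_mem_Icc.mpr hL
  have hlen : L ≤ F L - F 0 := by
    have h1 := h h0 hL'
    rw [inter_self] at h1
    have h2 := (hmono.eVariationOn_eq h0 hL').le
    rw [inter_self] at h2
    have h3 := h1.symm.le.trans (hvar.trans h2)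
    rw [ENNReal.ofReal_le_ofReal_iff (sub_nonneg.mpr (hmono h0 hL' hL))] at h3
    simpa using h3
  rw [hFsub 0 h0 L hL'] at hlen
  have hdef : ∫ t in (0 : ℝ)..L, (1 - ‖deriv x t‖) ≤ 0 := by
    rw [intervalIntegral.integral_sub intervalIntegrable_const hint]
    simpa using hlen
  have hnn : 0 ≤ᵐ[volume.restrict (Icc 0 L)] fun t => 1 - ‖deriv x t‖ := by
    filter_upwards [ae_differentiableAt_of_lipschitzOnWith hlip] with t ht
    exact sub_nonneg.mpr ht.2
  rw [intervalIntegral.integral_of_le hL, ← integral_Icc_eq_integral_Ioc] at hdef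
  have hi : IntegrableOn (fun t => 1 - ‖deriv x t‖) (Icc 0 L) :=
    (intervalIntegrable_iff_integrableOn_Icc_of_le hL).mp (intervalIntegrable_const.sub hint)
  have hz := (integral_eq_zero_iff_of_nonneg_ae hnn hi).mp
    (le_antisymm hdef (integral_nonneg_of_ae hnn))
  filter_upwards [hz] with t ht
  exact (sub_eq_zero.mp ht).symm

/-! ### Steepest descent curves -/

/-- Along a steepest descent curve the distance from a point already reached does not decrease. -/
lemma IsSteepestDescentCurve.norm_sub_mono {x : ℝ → Rn n} {L : ℝ}
    (h : IsSteepestDescentCurve x L) {τ p q : ℝ} (hτ : 0 ≤ τ) (hτp : τ ≤ p) (hpq : p ≤ q)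
    (hq : q ≤ L) : ‖x p - x τ‖ ≤ ‖x q - x τ‖ := by
  have hsub : Icc p q ⊆ Icc 0 L := Icc_subset_Icc (hτ.trans hτp) hq
  have hlip := (lipschitzOnWith_of_hasUnitSpeedOn h.unitSpeed).mono hsub
  have hN : AbsolutelyContinuousOnInterval (fun t => ‖x t - x τ‖) p q := by
    refine LipschitzOnWith.absolutelyContinuousOnInterval (K := 1) ?_
    rw [uIcc_of_le hpq]
    refine LipschitzOnWith.of_dist_le_mul fun t ht r hr => ?_
    rw [Real.dist_eq]
    refine (abs_norm_sub_norm_le _ _).trans ?_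
    rw [sub_sub_sub_cancel_right, ← dist_eq_norm]
    exact hlip.dist_le_mul t ht r hr
  have hg := hN.mul hN
  have h1 := hg.integral_deriv_eq_sub
  have h2 : 0 ≤ ∫ t in p..q, deriv ((fun t => ‖x t - x τ‖) * fun t => ‖x t - x τ‖) t := by
    refine intervalIntegral.integral_nonneg_of_ae_restrict hpq ?_
    filter_upwards [ae_differentiableAt_of_lipschitzOnWith hlip,
      ae_restrict_of_ae_restrict_of_subset hsub h.descent,
      ae_restrict_mem measurableSet_Icc] with t hd hdesc ht
    have hτL : τ ∈ Icc 0 L := ⟨hτ, hτp.trans (hpq.trans hq)⟩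
    have hnn := hdesc τ hτL (hτp.trans ht.1)
    have heq : ((fun t => ‖x t - x τ‖) * fun t => ‖x t - x τ‖) =
        fun t => ⟪x t - x τ, x t - x τ⟫ := by
      ext t
      exact (real_inner_self_eq_norm_mul_norm _).symm
    have hd' := hd.1.hasDerivAt.sub_const (x τ)
    rw [heq, (hd'.inner ℝ hd').deriv, real_inner_comm]
    exact add_nonneg hnn hnn
  rw [h1] at h2
  exact abs_le_of_sq_le_sq' (by simpa [sq] using h2) (norm_nonneg _) |>.2

/-- The chords from a point of a steepest descent curve back to earlier points form no obtuse
angle. -/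
lemma IsSteepestDescentCurve.inner_chord_nonneg {x : ℝ → Rn n} {L : ℝ}
    (h : IsSteepestDescentCurve x L) {s p q : ℝ} (hs : s ≤ L) (hp : p ∈ Icc 0 s)
    (hq : q ∈ Icc 0 s) : 0 ≤ ⟪x s - x p, x s - x q⟫ := by
  wlog hpq : p ≤ q generalizing p q
  · rw [real_inner_comm]
    exact this hq hp (le_of_not_ge hpq)
  have h1 := h.norm_sub_mono hp.1 hpq hq.2 hs
  have h2 := norm_sub_sq_real (x s - x p) (x s - x q)
  rw [sub_sub_sub_cancel_left] at h2
  have h3 := pow_le_pow_left₀ (norm_nonneg _) h1 2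
  nlinarith [sq_nonneg ‖x s - x q‖]

lemma isBounded_convexHull_arc {x : ℝ → Rn n} {L : ℝ} (h : IsSteepestDescentCurve x L) {s : ℝ}
    (hs : s ≤ L) : Bornology.IsBounded (convexHull ℝ (x '' Icc 0 s)) :=
  isBounded_convexHull.mpr (isCompact_Icc.image_of_continuousOn
    ((lipschitzOnWith_of_hasUnitSpeedOn h.unitSpeed).continuousOn.mono
      (Icc_subset_Icc_right hs))).isBounded

lemma convexHull_arc_mono (x : ℝ → Rn n) {s t : ℝ} (hst : s ≤ t) :
    convexHull ℝ (x '' Icc 0 s) ⊆ convexHull ℝ (x '' Icc 0 t) :=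
  convexHull_mono (image_mono (Icc_subset_Icc_right hst))

lemma convexHull_arc_nonempty (x : ℝ → Rn n) {s : ℝ} (hs : 0 ≤ s) :
    (convexHull ℝ (x '' Icc 0 s)).Nonempty :=
  (nonempty_Icc.mpr hs).image x |>.convexHull

lemma IsSteepestDescentCurve.monotoneOn_arcMeanWidth {x : ℝ → Rn n} {L : ℝ}
    (h : IsSteepestDescentCurve x L) : MonotoneOn (arcMeanWidth x) (Icc 0 L) :=
  fun _ hs _ ht hst => meanWidth_mono (convexHull_arc_nonempty x hs.1)
    (isBounded_convexHull_arc h ht.2) (convexHull_arc_mono x hst)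

/-- The directions in which the arc of `x` up to `s` is supported at its endpoint `x s`. -/
def normalSector (x : ℝ → Rn n) (s : ℝ) : Set (Sph n) :=
  polarSector ((fun τ => x s - x τ) '' Icc 0 s)

lemma IsSteepestDescentCurve.normalSector_mem_classC {x : ℝ → Rn n} {L : ℝ}
    (h : IsSteepestDescentCurve x L) {s : ℝ} (hs : s ≤ L) : normalSector x s ∈ classC n := by
  refine polarSector_mem_classC ?_
  rintro _ ⟨p, hp, rfl⟩ _ ⟨q, hq, rfl⟩
  exact h.inner_chord_nonneg hs hp hq

/-- A velocity is a limit of directions of backward chords, hence dual to the normal sector. -/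
lemma inner_velocity_nonneg {x : ℝ → Rn n} {s : ℝ} (hs : 0 < s) {v : Rn n}
    (hx : HasDerivAt x v s) {θ : Sph n} (hθ : θ ∈ normalSector x s) :
    0 ≤ ⟪v, (θ : Rn n)⟫ := by
  have h1 : HasDerivAt (fun t => ⟪(θ : Rn n), x t⟫) ⟪(θ : Rn n), v⟫ s := by
    simpa using (hasDerivAt_const s (θ : Rn n)).inner ℝ hx
  rw [real_inner_comm]
  refine ge_of_tendsto (h1.tendsto_slope.mono_left (nhdsLT_le_nhdsNE s)) ?_
  filter_upwards [Ioo_mem_nhdsLT hs] with t ht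
  have h2 := hθ _ ⟨t, ⟨ht.1.le, ht.2.le⟩, rfl⟩
  simp only [inner_sub_right] at h2
  rw [slope_def_field]
  exact div_nonneg_of_nonpos (by linarith) (by linarith [ht.2])

/-- Compare `w_γ` to the right of `s` with `t ↦ (2 / ωₙ) ∫_S ⟨θ, x t⟩ dσ(θ)`, whose derivative at `s`
is `Φ(S, x'(s))`. -/
lemma IsSteepestDescentCurve.Phi_le_deriv {x : ℝ → Rn n} {L : ℝ}
    (h : IsSteepestDescentCurve x L) {s : ℝ} (hs : s ∈ Ioo 0 L) {u : Sph n}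
    (hx : HasDerivAt x u s) (hw : DifferentiableAt ℝ (arcMeanWidth x) s) :
    Phi (normalSector x s) u ≤ deriv (arcMeanWidth x) s := by
  set S := normalSector x s with hSdef
  have hS : MeasurableSet S := (isClosed_polarSector _).measurableSet
  -- the integral over `S` is linear in the vector, which makes the derivative immediate
  set c : Rn n := ∫ θ in S, (θ : Rn n) ∂(sigma n) with hc
  have hint : Integrable (fun θ : Sph n => (θ : Rn n)) ((sigma n).restrict S) :=
    (continuous_subtype_val.integrable_of_hasCompactSupport
      (HasCompactSupport.of_compactSpace _))
  have hlin : ∀ v : Rn n, ∫ θ in S, ⟪(θ : Rn n), v⟫ ∂(sigma n) = ⟪v, c⟫ := by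
    intro v
    rw [hc, ← integral_inner hint v]
    simp_rw [real_inner_comm v]
  have hG : HasDerivAt (fun t => 2 / omega n * ⟪x t, c⟫) (Phi S u) s := by
    have h1 : HasDerivAt (fun t => ⟪x t, c⟫) ⟪(u : Rn n), c⟫ s := by
      simpa using hx.inner ℝ (hasDerivAt_const s c)
    simpa only [Phi, hlin] using h1.const_mul (2 / omega n)
  refine le_of_tendsto_of_tendsto (hG.tendsto_slope.mono_left (nhdsGT_le_nhdsNE s))
    (hw.hasDerivAt.tendsto_slope.mono_left (nhdsGT_le_nhdsNE s)) ?_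
  filter_upwards [Ioo_mem_nhdsGT hs.2] with t ht
  rw [slope_def_field, slope_def_field]
  refine div_le_div_of_nonneg_right ?_ (by linarith [ht.1])
  have hmem : x t ∈ convexHull ℝ (x '' Icc 0 t) :=
    subset_convexHull ℝ _ ⟨t, right_mem_Icc.mpr (hs.1.le.trans ht.1.le), rfl⟩
  have hp : ∀ θ ∈ S, ∀ y ∈ convexHull ℝ (x '' Icc 0 s), ⟪(θ : Rn n), y⟫ ≤ ⟪(θ : Rn n), x s⟫ := by
    intro θ hθ
    have hconv : Convex ℝ {y : Rn n | ⟪(θ : Rn n), y⟫ ≤ ⟪(θ : Rn n), x s⟫} :=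
      convex_halfSpace_le (innerSL ℝ (θ : Rn n)).isLinear _
    refine fun y hy => convexHull_min ?_ hconv hy
    rintro _ ⟨τ, hτ, rfl⟩
    have h2 := hθ _ ⟨τ, hτ, rfl⟩
    simp only [inner_sub_right] at h2
    exact sub_nonneg.mp h2
  have := le_meanWidth_sub (convexHull_arc_nonempty x hs.1.le) (isBounded_convexHull_arc h ht.2.le)
    (convexHull_arc_mono x ht.1.le) hS hmem hp
  rwa [hlin, inner_sub_left, mul_sub] at this

end SteepestDescent

theorem theorem5p1 (n : ℕ) (hn : 2 ≤ n) :
    ∃ m : ℝ, 0 < m ∧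
      IsLeast {r : ℝ | ∃ S ∈ SteepestDescent.classC n, ∃ u ∈ SteepestDescent.dualSector S,
        r = SteepestDescent.Phi S u} m ∧
      ∀ (L : ℝ) (x : ℝ → SteepestDescent.Rn n), SteepestDescent.IsSteepestDescentCurve x L →
        ∀ᵐ s ∂(volume.restrict (Icc 0 L)),
          DifferentiableAt ℝ (SteepestDescent.arcMeanWidth x) s ∧
            m ≤ deriv (SteepestDescent.arcMeanWidth x) s := by
  obtain ⟨m, hm, hleast⟩ := SteepestDescent.exists_isLeast_Phi hn
  refine ⟨m, hm, hleast, fun L x h => ?_⟩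
  have hlip := SteepestDescent.lipschitzOnWith_of_hasUnitSpeedOn h.unitSpeed
  filter_upwards [SteepestDescent.ae_mem_Ioo 0 L,
    SteepestDescent.ae_differentiableAt_of_lipschitzOnWith hlip,
    SteepestDescent.ae_norm_deriv_eq_one h.length_nonneg h.unitSpeed,
    h.monotoneOn_arcMeanWidth.ae_differentiableWithinAt measurableSet_Icc] with s hs hd hu hw
  have hw' := hw.differentiableAt (Icc_mem_nhds hs.1 hs.2)
  set u : SteepestDescent.Sph n := ⟨deriv x s, by simpa using hu⟩
  refine ⟨hw', (hleast.2 ⟨_, h.normalSector_mem_classC hs.2.le, u, fun θ hθ => ?_, rfl⟩).trans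
    (h.Phi_le_deriv hs (u := u) hd.1.hasDerivAt hw')⟩
  exact SteepestDescent.inner_velocity_nonneg hs.1 hd.1.hasDerivAt hθ
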